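/- Let $s\ge 2$ be an integer and $n=(2^{2s}+1)(2^s-1)$. Let $\beta$ be a primitive $n$-th root of unity in an extension field of $\mathrm{GF}(2)$, for example $\beta=\alpha^{2^s+1}$ with $\alpha$ a primitive element of $\mathrm{GF}(2^{4s})$. Let $\mathcal C=\mathcal C_{(2,n,3,1)}$ be the binary BCH code of length $n$ and designed distance $3$, i.e. the cyclic code of length $n$ over $\mathrm{GF}(2)$ that corresponds, under $(c_0,\dots,c_{n-1})\mapsto\sum_i c_ix^i$, to the ideal of $\mathrm{GF}(2)[x]/\langle x^n-1\rangle$ generated by $\mathrm{lcm}(\mathsf M_{\beta}(x),\mathsf M_{\beta^2}(x))$, where $\mathsf M_{\gamma}(x)$ is the minimal polynomial of $\gamma$ over $\mathrm{GF}(2)$. Let $$\overline{\mathcal C}=\Big\{(c_1,\dots,c_{n+1}) : (c_1,\dots,c_n)\in\mathcal C,\ c_{n+1}=-\sum_{i=1}^n c_i\Big\}$$ be its extended code and let $\overline{\mathcal C}^{\perp}$ be the Euclidean dual of $\overline{\mathcal C}$. An $[N,k,d]$ code is a linear code of length $N$, dimension $k$ and minimum Hamming distance $d$. Then $\overline{\mathcal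 C}$ is an $[n+1,\,n-4s,\,4]$ code and is distance-optimal with respect to the sphere packing bound: no binary $[n+1,n-4s,d']$ linear code with $d'\ge 5$ exists, and for every $d'\ge 5$ the sphere packing inequality $\sum_{i=0}^{\lfloor (d'-1)/2\rfloor}\binom{n+1}{i}\le 2^{(n+1)-(n-4s)}$ fails. Furthermore, $\overline{\mathcal C}^{\perp}$ is an $[n+1,\,4s+1,\,n+1-2^{3s-1}]$ code, its nonzero codewords have exactly five distinct Hamming weights, and its weight enumerator $\sum_{j=0}^{n+1}A_jz^j$, where $A_j$ is the number of codewords of Hamming weight $j$, is $$1+n z^{\,n+1-2^{3s-1}}+(2^{4s}-1-n)z^{\,2^{3s-1}-2^{2s-1}}+(2^{4s}-1-n)z^{\,n+1-2^{3s-1}+2^{2s-1}}+n z^{\,2^{3s-1}}+z^{\,n+1}.$$ -/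

import Mathlib

open Polynomial

namespace Coding

noncomputable section

section Codes

variable {F : Type*} [Field F] [DecidableEq F] {n : ℕ}

/-- `d` is the minimum Hamming distance of the code `C`: the smallest distance between two distinct
codewords. -/
def HasMinDist (C : Submodule F (Fin n → F)) (d : ℕ) : Prop :=
  IsLeast {w : ℕ | ∃ x ∈ C, ∃ y ∈ C, x ≠ y ∧ hammingDist x y = w} d

/-- `C`, a linear code of length `n`, is an `[n, k, d]` code. -/
def HasParameters (C : Submodule F (Fin n → F)) (k d : ℕ) : Prop :=
  Module.finrank F C = k ∧ HasMinDist C d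

/-- The sphere packing (Hamming) inequality for the parameters `[n, k, d]` over a field with `q`
elements (used with `1 ≤ d` and `k ≤ n`). -/
def SpherePackingBound (q n k d : ℕ) : Prop :=
  ∑ i ∈ Finset.range ((d - 1) / 2 + 1), n.choose i * (q - 1) ^ i ≤ q ^ (n - k)

/-- `C` is distance-optimal: no linear code with the same length and dimension has a larger
minimum distance. -/
def IsDistanceOptimal (C : Submodule F (Fin n → F)) : Prop :=
  ∃ k d, HasParameters C k d ∧
    ¬ ∃ (D : Submodule F (Fin n → F)) (d' : ℕ), d < d' ∧ HasParameters D k d'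

/-- The sphere packing bound already rules out every minimum distance larger than that of `C`, for
the length and dimension of `C`. -/
def SpherePackingExcludesLarger (C : Submodule F (Fin n → F)) : Prop :=
  ∃ k d, HasParameters C k d ∧ ∀ d' : ℕ, d < d' → ¬ SpherePackingBound (Nat.card F) n k d'

/-- `C` is distance-optimal with respect to the sphere packing bound. -/
def IsDistanceOptimalForSpherePacking (C : Submodule F (Fin n → F)) : Prop :=
  IsDistanceOptimal C ∧ SpherePackingExcludesLarger C

/-- The number `A_w(C)` of codewords of Hamming weight `w`. -/
def weightCount (C : Submodule F (Fin n → F)) (w : ℕ) : ℕ :=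
  {c : Fin n → F | c ∈ C ∧ hammingNorm c = w}.ncard

/-- The weight enumerator `∑_{j=0}^n A_j(C) z^j`. -/
def weightEnumerator (C : Submodule F (Fin n → F)) : ℕ[X] :=
  ∑ j ∈ Finset.range (n + 1), Polynomial.C (weightCount C j) * X ^ j

/-- The nonzero codewords of `C` have exactly `t` different Hamming weights. -/
def IsWeightCode (t : ℕ) (C : Submodule F (Fin n → F)) : Prop :=
  {w : ℕ | ∃ c ∈ C, c ≠ 0 ∧ hammingNorm c = w}.ncard = t

end Codes

section Constructions

variable {F : Type*} [Field F] {n : ℕ}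

/-- The Euclidean dual code. -/
def dualCode (C : Submodule F (Fin n → F)) : Submodule F (Fin n → F) where
  carrier := {b | ∀ c ∈ C, ∑ i, b i * c i = 0}
  add_mem' := by
    intro a b ha hb c hc
    simp [add_mul, Finset.sum_add_distrib, ha c hc, hb c hc]
  zero_mem' := by
    intro c _
    simp
  smul_mem' := by
    intro r b hb c hc
    simp [mul_assoc, ← Finset.mul_sum, hb c hc]

/-- The extended code `{(c_1, …, c_n, c_{n+1}) : (c_1, …, c_n) ∈ C, c_{n+1} = -∑ c_i}`. -/
def extendedCode (C : Submodule F (Fin n → F)) : Submodule F (Fin (n + 1) → F) where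
  carrier := {x | (fun i : Fin n => x i.castSucc) ∈ C ∧
    x (Fin.last n) = -∑ i : Fin n, x i.castSucc}
  add_mem' := by
    rintro a b ⟨ha, ha'⟩ ⟨hb, hb'⟩
    refine ⟨C.add_mem ha hb, ?_⟩
    simp only [Pi.add_apply, Finset.sum_add_distrib, ha', hb']
    ring
  zero_mem' := ⟨C.zero_mem, by simp⟩
  smul_mem' := by
    rintro r a ⟨ha, ha'⟩
    refine ⟨C.smul_mem r ha, ?_⟩
    simp only [Pi.smul_apply, smul_eq_mul, ha', ← Finset.mul_sum]
    ring

/-- The vector `(c_0, …, c_{n-1})` as the class of `c_0 + c_1 x + ⋯ + c_{n-1} x^{n-1}` in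
`F[x] / (x^n - 1)`. -/
def toCyclicRing (F : Type*) [Field F] (n : ℕ) :
    (Fin n → F) →ₗ[F] (F[X] ⧸ Ideal.span {(X ^ n - 1 : F[X])}) :=
  (Ideal.Quotient.mkₐ F (Ideal.span {(X ^ n - 1 : F[X])})).toLinearMap ∘ₗ
    ∑ i : Fin n, (Polynomial.monomial (i : ℕ)) ∘ₗ LinearMap.proj i

/-- The cyclic code of length `n` that corresponds to the ideal of `F[x] / (x^n - 1)` generated by
the class of `g`. -/
def cyclicCode (n : ℕ) (g : F[X]) : Submodule F (Fin n → F) :=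
  ((Ideal.span {Ideal.Quotient.mk (Ideal.span {(X ^ n - 1 : F[X])}) g}).restrictScalars F).comap
    (toCyclicRing F n)

/-- The monic least common multiple, over `F[x]`, of the minimal polynomials over `F` of
`β^b, β^(b+1), …, β^(b+δ-2)`. -/
def bchGenerator (F : Type*) [Field F] {K : Type*} [Field K] [Algebra F K] (β : K)
    (δ : ℕ) (b : ℤ) : F[X] :=
  letI : DecidableEq F := Classical.decEq F
  letI : NormalizedGCDMonoid F[X] := UniqueFactorizationMonoid.toNormalizedGCDMonoid F[X]
  (Finset.range (δ - 1)).lcm fun j => minpoly F (β ^ (b + (j : ℤ)))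

/-- The BCH code of length `n` and designed distance `δ ≥ 2` over `F`, with respect to the
primitive `n`-th root of unity `β` in an extension field of `F`. -/
def bchCode (F : Type*) [Field F] {K : Type*} [Field K] [Algebra F K] (β : K)
    (n δ : ℕ) (b : ℤ) : Submodule F (Fin n → F) :=
  cyclicCode n (bchGenerator F β δ b)

end Constructions

end

end Coding

/-!
Put `q = 2 ^ s`, so that `n * (q + 1) = q ^ 4 - 1`. The codes depend on `β` only through its minimal
polynomial, so `β` may be taken in the field `L` with `q ^ 4` elements
(`Coding.exists_isPrimitiveRoot_bchCode_eq`). A word belongs to the BCH code exactly when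
`∑ c i * β ^ i = 0`, the conjugate root `β ^ 2` being automatic. Adding the locator `0` for the parity
coordinate, the extended code consists of the words with `∑ c i * u i = 0` and `∑ c i = 0`, where `u`
lists the `n`-th roots of unity and zero. By duality and nondegeneracy of the trace form, its dual
consists of the words `i ↦ Tr (a * u i) + b` with `a ∈ L` and `b ∈ ZMod 2`.

The weight of such a word is governed by `∑ (-1) ^ Tr (a * y)` over the `n`-th roots of unity `y`. These
are the `(q + 1)`-th powers, each attained `q + 1` times, so the sum `S` satisfies
`1 + (q + 1) * S = T` with `T = ∑ (-1) ^ Tr (a * x ^ (q + 1))` over all `x ∈ L`. The exponent is a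
quadratic form in `x`, and squaring `T` gives `q ^ 4` times the size of its radical
(`sq_sum_traceChar_mul_pow`). For `a ≠ 0` the radical has `q ^ 2` elements when `a ^ n = 1` and is
trivial otherwise, hence `T` is `± q ^ 3` or `± q ^ 2`; the congruence `T ≡ 1` modulo `q + 1` decides
the sign (`one_add_sum_traceChar`). This determines all weights and their multiplicities. No nonzero
pair `(a, b)` gives weight zero, and this yields the dimensions of both codes.

The extended code has only even weights, and weight two is excluded because the locators are distinct.
Conversely `(n + 1).choose 2` exceeds the number `2 ^ (4 * s + 1)` of cosets of any binary code with
the same length and dimension, so each such code has a nonzero word of weight at most four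
(`Coding.exists_hammingNorm_le_four`). This gives both the minimum distance and its optimality.
-/

/-! ### Roots of unity in finite fields -/

section RootsOfUnity

lemma FiniteField.exists_isPrimitiveRoot_of_dvd {L : Type*} [Field L] [Fintype L] {d : ℕ}
    (hd : d ∣ Fintype.card L - 1) : ∃ ζ : L, IsPrimitiveRoot ζ d := by
  classical
  obtain ⟨g, hg⟩ := IsCyclic.exists_generator (α := Lˣ)
  have hord : orderOf g = Fintype.card L - 1 := by
    rw [orderOf_eq_card_of_forall_mem_zpowers hg, Nat.card_eq_fintype_card, Fintype.card_units]
  have hg' : IsPrimitiveRoot (g : L) (Fintype.card L - 1) := by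
    rw [← hord]; exact IsPrimitiveRoot.coe_units_iff.2 (IsPrimitiveRoot.orderOf g)
  obtain ⟨e, he⟩ := hd
  have hpos : 0 < Fintype.card L - 1 := Nat.sub_pos_of_lt Fintype.one_lt_card
  exact ⟨_, hg'.pow hpos (he.trans (mul_comm _ _))⟩

lemma IsPrimitiveRoot.sum_range_eq_sum_nthRootsFinset {R M : Type*} [CommRing R]
    [IsDomain R] [AddCommMonoid M] {ζ : R} {n : ℕ} (hζ : IsPrimitiveRoot ζ n) (hn : 0 < n) (f : R → M) :
    ∑ i ∈ Finset.range n, f (ζ ^ i) = ∑ y ∈ nthRootsFinset n (1 : R), f y := by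
  refine Finset.sum_bij (fun i _ => ζ ^ i) ?_ ?_ ?_ ?_
  · intro i _
    rw [Polynomial.mem_nthRootsFinset hn, ← pow_mul, mul_comm, pow_mul, hζ.pow_eq_one, one_pow]
  · intro i hi j hj h
    exact hζ.pow_inj (Finset.mem_range.1 hi) (Finset.mem_range.1 hj) h
  · intro y hy
    have : NeZero n := ⟨hn.ne'⟩
    obtain ⟨i, hi, h⟩ := hζ.eq_pow_of_pow_eq_one ((Polynomial.mem_nthRootsFinset hn 1).1 hy)
    exact ⟨i, Finset.mem_range.2 hi, h⟩
  · intros; rfl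

variable {L : Type*} [Field L] [Fintype L]

/-- In a finite field with `n * d + 1` elements, the `n`-th roots of unity are the `d`-th powers of
nonzero elements. -/
lemma FiniteField.exists_pow_eq_of_pow_eq_one {n d : ℕ} (hnd : n * d = Fintype.card L - 1) {y : L}
    (hy : y ^ n = 1) : ∃ w : L, w ≠ 0 ∧ w ^ d = y := by
  have hpos : 0 < n * d := hnd ▸ Nat.sub_pos_of_lt Fintype.one_lt_card
  obtain ⟨g, hg⟩ := FiniteField.exists_isPrimitiveRoot_of_dvd (L := L) hnd.dvd
  have hγ : IsPrimitiveRoot (g ^ d) n := hg.pow hpos (mul_comm n d)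
  have : NeZero n := ⟨(Nat.pos_of_mul_pos_right hpos).ne'⟩
  obtain ⟨i, -, h⟩ := hγ.eq_pow_of_pow_eq_one hy
  exact ⟨g ^ i, pow_ne_zero _ (hg.ne_zero hpos.ne'), by rw [← h, ← pow_mul, ← pow_mul, mul_comm]⟩

/-- Every `n`-th root of unity is a `d`-th power in exactly `d` ways, when the field has `n * d + 1`
elements. -/
lemma FiniteField.sum_pow_eq_mul_sum_nthRoots [DecidableEq L] {n d : ℕ}
    (hnd : n * d = Fintype.card L - 1) (f : L → ℤ) :
    ∑ x, f (x ^ d) = f 0 + d * ∑ y ∈ nthRootsFinset n (1 : L), f y := by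
  classical
  have hpos : 0 < n * d := hnd ▸ Nat.sub_pos_of_lt Fintype.one_lt_card
  have hn : 0 < n := Nat.pos_of_mul_pos_right hpos
  have hd : 0 < d := Nat.pos_of_mul_pos_left hpos
  rw [← Finset.add_sum_erase _ _ (Finset.mem_univ (0 : L)), zero_pow hd.ne']
  congr 1
  have hmaps : ∀ x ∈ Finset.univ.erase (0 : L), x ^ d ∈ nthRootsFinset n (1 : L) := by
    intro x hx
    rw [mem_nthRootsFinset hn, ← pow_mul, mul_comm, hnd]
    exact FiniteField.pow_card_sub_one_eq_one x (Finset.ne_of_mem_erase hx)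
  rw [← Finset.sum_fiberwise_of_maps_to hmaps, Finset.mul_sum]
  refine Finset.sum_congr rfl fun y hy => ?_
  rw [mem_nthRootsFinset hn] at hy
  obtain ⟨w, hw, rfl⟩ := FiniteField.exists_pow_eq_of_pow_eq_one hnd hy
  have hfib : (Finset.univ.erase (0 : L)).filter (fun x => x ^ d = w ^ d) =
      (nthRootsFinset d (1 : L)).image (fun u => w * u) := by
    ext x
    simp only [Finset.mem_filter, Finset.mem_erase, Finset.mem_univ, and_true, Finset.mem_image,
      mem_nthRootsFinset hd]
    constructor
    · rintro ⟨-, h⟩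
      refine ⟨x / w, ?_, by field_simp⟩
      rw [div_pow, h, div_self (pow_ne_zero _ hw)]
    · rintro ⟨u, hu, rfl⟩
      refine ⟨mul_ne_zero hw ?_, by rw [mul_pow, hu, mul_one]⟩
      rintro rfl
      rw [zero_pow hd.ne'] at hu
      exact zero_ne_one hu
  obtain ⟨ζ, hζ⟩ := FiniteField.exists_isPrimitiveRoot_of_dvd (L := L) (d := d)
    ⟨n, by rw [← hnd, mul_comm]⟩
  have hcard : ((Finset.univ.erase (0 : L)).filter (fun x => x ^ d = w ^ d)).card = d := by
    rw [hfib, Finset.card_image_of_injective _ (mul_right_injective₀ hw), hζ.card_nthRootsFinset]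
  rw [Finset.sum_congr rfl (g := fun _ => f (w ^ d))
    (fun x hx => by rw [(Finset.mem_filter.1 hx).2]), Finset.sum_const, hcard, nsmul_eq_mul]

end RootsOfUnity

/-! ### The radical of `x ↦ Tr (a * x ^ (q + 1))` -/

section Radical

variable {L : Type*} [Field L] [Fintype L]

/-- For `a` an `n`-th root of unity, the radical of `x ↦ Tr (a * x ^ (q + 1))` has `q ^ 2`
elements. The radical is cut out by `a * z = a ^ q * z ^ q ^ 2`; with `a = w ^ (q + 1)` this says that
`w * z` lies in the subfield with `q ^ 2` elements. -/
lemma card_radical_of_pow_eq_one [DecidableEq L] {s n : ℕ} (hs : 1 ≤ s)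
    (hL : Fintype.card L = 2 ^ (4 * s))
    (hn : n * (2 ^ s + 1) = 2 ^ (4 * s) - 1) {a : L} (ha : a ^ n = 1) :
    (Finset.univ.filter fun z : L => a * z = a ^ 2 ^ s * z ^ 2 ^ (2 * s)).card = 2 ^ (2 * s) := by
  obtain ⟨w, hw, rfl⟩ := FiniteField.exists_pow_eq_of_pow_eq_one (hn.trans (by rw [hL])) ha
  have hq1 : 1 < 2 ^ (2 * s) := Nat.one_lt_two_pow (by omega)
  have hss : (2 ^ s) ^ 2 = 2 ^ (2 * s) := by rw [← pow_mul, mul_comm]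
  have hd : 0 < 2 ^ (2 * s) - 1 := by omega
  obtain ⟨ζ, hζ⟩ := FiniteField.exists_isPrimitiveRoot_of_dvd (L := L) (d := 2 ^ (2 * s) - 1)
    ⟨2 ^ (2 * s) + 1, by
      rw [hL, show 4 * s = 2 * s + 2 * s by ring, pow_add]
      obtain ⟨m, hm⟩ : ∃ m, 2 ^ (2 * s) = m + 1 := ⟨_, (Nat.succ_pred (by positivity)).symm⟩
      rw [hm]; simp only [Nat.add_sub_cancel]; rw [Nat.sub_eq_iff_eq_add (by nlinarith)]; ring⟩
  have key : (Finset.univ.filter fun z : L =>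
      w ^ (2 ^ s + 1) * z = (w ^ (2 ^ s + 1)) ^ 2 ^ s * z ^ 2 ^ (2 * s)) =
      (insert 0 (nthRootsFinset (2 ^ (2 * s) - 1) (1 : L))).image (fun u => w⁻¹ * u) := by
    have hw' : ∀ z : L, (w ^ (2 ^ s + 1)) ^ 2 ^ s * z ^ 2 ^ (2 * s) =
        w ^ 2 ^ s * (w * z) ^ 2 ^ (2 * s) := by
      intro z
      rw [← pow_mul, add_mul, one_mul, pow_add, ← pow_two, hss, mul_pow]; ring
    ext z
    simp only [Finset.mem_filter, Finset.mem_univ, true_and, Finset.mem_image, Finset.mem_insert,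
      mem_nthRootsFinset hd]
    rw [hw', pow_succ, mul_assoc, mul_right_inj' (pow_ne_zero _ hw)]
    have hpw : ∀ u : L, u = u ^ 2 ^ (2 * s) ↔ u = 0 ∨ u ^ (2 ^ (2 * s) - 1) = 1 := by
      intro u
      by_cases hu : u = 0
      · simp [hu]
      · rw [← Nat.sub_add_cancel hq1.le, pow_succ, Nat.add_sub_cancel, eq_comm,
          mul_eq_right₀ hu]
        simp [hu]
    rw [hpw]
    constructor
    · intro h
      exact ⟨w * z, h, by field_simp⟩
    · rintro ⟨u, hu, rfl⟩
      rwa [mul_inv_cancel_left₀ hw]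
  rw [key, Finset.card_image_of_injective _ (mul_right_injective₀ (inv_ne_zero hw)),
    Finset.card_insert_of_notMem, hζ.card_nthRootsFinset]
  · omega
  · rw [mem_nthRootsFinset hd, zero_pow hd.ne']; exact zero_ne_one

/-- For `a` neither zero nor an `n`-th root of unity, the quadratic form `x ↦ Tr (a * x ^ (q + 1))`
is nondegenerate: a nonzero `z` in the radical makes `a * z ^ (q + 1)` a nonzero element of the
subfield with `q` elements, hence an `n`-th root of unity, and then so is `a`. -/
lemma card_radical_of_pow_ne_one [DecidableEq L] {s n : ℕ}
    (hL : Fintype.card L = 2 ^ (4 * s))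
    (hn : n = (2 ^ (2 * s) + 1) * (2 ^ s - 1)) (hn' : n * (2 ^ s + 1) = 2 ^ (4 * s) - 1)
    {a : L} (ha0 : a ≠ 0) (ha : a ^ n ≠ 1) :
    (Finset.univ.filter fun z : L => a * z = a ^ 2 ^ s * z ^ 2 ^ (2 * s)).card = 1 := by
  rw [Finset.card_eq_one]
  refine ⟨0, ?_⟩
  ext z
  simp only [Finset.mem_filter, Finset.mem_univ, true_and, Finset.mem_singleton]
  refine ⟨fun h => ?_, fun h => by simp [h]⟩
  by_contra hz
  apply ha
  have hss : (2 ^ s) ^ 2 = 2 ^ (2 * s) := by rw [← pow_mul, mul_comm]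
  set u := a * z ^ (2 ^ s + 1) with hu
  have hu0 : u ≠ 0 := mul_ne_zero ha0 (pow_ne_zero _ hz)
  have hus : u ^ 2 ^ s = u := by
    rw [hu, mul_pow, ← pow_mul, add_mul, one_mul, pow_add, ← pow_two, hss, ← mul_assoc, ← h]
    ring
  have hu1 : u ^ (2 ^ s - 1) = 1 := by
    rw [← mul_eq_right₀ hu0, ← pow_succ, Nat.sub_add_cancel Nat.one_le_two_pow, hus]
  have hun : u ^ n = 1 := by rw [hn, mul_comm, pow_mul, hu1, one_pow]
  rw [hu, mul_pow, ← pow_mul, mul_comm (2 ^ s + 1) n, hn', ← hL,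
    FiniteField.pow_card_sub_one_eq_one z hz, mul_one] at hun
  exact hun

end Radical

/-! ### The sums of the trace character over the roots of unity -/

section CharacterSums

/-- The nontrivial additive character of `ZMod 2`, with integer values. -/
def signChar : AddChar (ZMod 2) ℤ where
  toFun x := if x = 0 then 1 else -1
  map_zero_eq_one' := by decide
  map_add_eq_mul' := by decide

lemma signChar_zero : signChar 0 = 1 := rfl
lemma signChar_one : signChar 1 = -1 := rfl

variable (L : Type*) [Field L] [Algebra (ZMod 2) L]

/-- The canonical additive character `x ↦ (-1) ^ Tr x` of a field of characteristic two. -/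
noncomputable def traceChar : AddChar L ℤ :=
  signChar.compAddMonoidHom (Algebra.trace (ZMod 2) L).toAddMonoidHom

variable {L}

lemma traceChar_apply (x : L) : traceChar L x = signChar (Algebra.trace (ZMod 2) L x) := rfl

variable [Fintype L]

lemma traceChar_isPrimitive : (traceChar L).IsPrimitive := by
  apply AddChar.IsPrimitive.of_ne_one
  intro h
  obtain ⟨x, hx⟩ := Algebra.trace_surjective (ZMod 2) L 1
  have := DFunLike.congr_fun h x
  rw [traceChar_apply, hx, signChar_one, AddChar.one_apply] at this
  norm_num at this

variable [CharP L 2]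

lemma trace_pow_two_pow (x : L) (k : ℕ) :
    Algebra.trace (ZMod 2) L (x ^ 2 ^ k) = Algebra.trace (ZMod 2) L x := by
  induction k with
  | zero => simp
  | succ k ih =>
    rw [← ih, pow_succ 2 k, pow_mul]
    have h := Algebra.trace_eq_of_algEquiv (FiniteField.frobeniusAlgEquiv (ZMod 2) L 2) (x ^ 2 ^ k)
    simpa [ZMod.card] using h

/-- The quadratic form `x ↦ Tr (a * x ^ (q + 1))` has polarization
`(y, z) ↦ Tr ((a * z ^ q + (a * z) ^ q ^ 3) * y)`, so squaring its exponential sum leaves a sum over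
the radical. On the radical `a * z ^ (q + 1)` lies in the subfield with `q` elements, where the trace
vanishes. -/
lemma sq_sum_traceChar_mul_pow [DecidableEq L] {s : ℕ} (hL : Fintype.card L = 2 ^ (4 * s)) (a : L) :
    (∑ x : L, traceChar L (a * x ^ (2 ^ s + 1))) ^ 2 =
      2 ^ (4 * s) *
        (Finset.univ.filter fun z : L => (a * z) = a ^ 2 ^ s * z ^ 2 ^ (2 * s)).card := by
  have hfrob : ∀ x : L, x ^ 2 ^ (4 * s) = x := fun x => hL ▸ FiniteField.pow_card x
  have hs : (2 ^ s) ^ 2 = 2 ^ (2 * s) := by rw [← pow_mul, mul_comm]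
  have hadd : ∀ x y : L, (x + y) ^ 2 ^ s = x ^ 2 ^ s + y ^ 2 ^ s :=
    fun x y => add_pow_char_pow x y 2 s
  -- `Tr (a * z * y ^ q)` is made linear in `y` by applying the `q ^ 3`-power Frobenius map.
  have hpol : ∀ y z : L, traceChar L (a * (z + y) ^ (2 ^ s + 1)) * traceChar L (a * y ^ (2 ^ s + 1))
      = traceChar L (a * z ^ (2 ^ s + 1)) *
        traceChar L (y * (a * z ^ 2 ^ s + (a * z) ^ 2 ^ (3 * s))) := by
    intro y z
    have h1 : traceChar L (a * z * y ^ 2 ^ s) = traceChar L (y * (a * z) ^ 2 ^ (3 * s)) := by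
      rw [traceChar_apply, traceChar_apply, ← trace_pow_two_pow (a * z * y ^ 2 ^ s) (3 * s), mul_pow,
        ← pow_mul y, ← pow_add, show s + 3 * s = 4 * s by ring, hfrob, mul_comm]
    rw [mul_add, AddChar.map_add_eq_mul (traceChar L) (y * _), ← h1, ← AddChar.map_add_eq_mul,
      ← AddChar.map_add_eq_mul, ← AddChar.map_add_eq_mul, pow_succ, hadd]
    congr 1
    have h2 : a * y ^ (2 ^ s + 1) + a * y ^ (2 ^ s + 1) = 0 := CharTwo.add_self_eq_zero _
    rw [pow_succ] at h2 ⊢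
    linear_combination h2
  have hrad : ∀ z : L, a * z ^ 2 ^ s + (a * z) ^ 2 ^ (3 * s) = 0 ↔
      a * z = a ^ 2 ^ s * z ^ 2 ^ (2 * s) := by
    intro z
    -- Apply the `q`-power Frobenius map to both sides.
    rw [CharTwo.add_eq_zero, ← (iterateFrobenius_inj L 2 s).eq_iff, iterateFrobenius_def,
      iterateFrobenius_def, ← pow_mul (a * z), ← pow_add, show 3 * s + s = 4 * s by ring, hfrob,
      mul_pow, ← pow_mul z, ← pow_add, ← two_mul, eq_comm]
  have hval : ∀ z : L, a * z = a ^ 2 ^ s * z ^ 2 ^ (2 * s) →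
      traceChar L (a * z ^ (2 ^ s + 1)) = 1 := by
    intro z hz
    set u := a * z ^ (2 ^ s + 1) with hu
    have hus : u ^ 2 ^ s = u := by
      rw [hu, mul_pow, ← pow_mul, add_mul, one_mul, pow_add, ← pow_two, hs, ← mul_assoc, ← hz]
      ring
    have hu2 : u ^ 2 ^ (2 * s) = u := by rw [← hs, pow_two, pow_mul, hus, hus]
    have hrank : Module.finrank (ZMod 2) L = 2 * s + 2 * s := by
      have := Module.card_eq_pow_finrank (K := ZMod 2) (V := L)
      rw [hL, ZMod.card] at this
      have := Nat.pow_right_injective le_rfl this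
      omega
    have htr : algebraMap (ZMod 2) L (Algebra.trace (ZMod 2) L u) = 0 := by
      rw [FiniteField.algebraMap_trace_eq_sum_pow, hrank, Nat.card_zmod, Finset.sum_range_add]
      simp_rw [pow_add, pow_mul u, hu2]
      exact CharTwo.add_self_eq_zero _
    rw [traceChar_apply, (map_eq_zero _).1 htr, signChar_zero]
  rw [pow_two, Finset.sum_mul_sum, Finset.sum_comm]
  calc ∑ y : L, ∑ x : L, traceChar L (a * x ^ (2 ^ s + 1)) * traceChar L (a * y ^ (2 ^ s + 1))
      = ∑ y : L, ∑ z : L,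
          traceChar L (a * (z + y) ^ (2 ^ s + 1)) * traceChar L (a * y ^ (2 ^ s + 1)) :=
        Finset.sum_congr rfl fun y _ => (Equiv.sum_comp (Equiv.addRight y) fun x =>
          traceChar L (a * x ^ (2 ^ s + 1)) * traceChar L (a * y ^ (2 ^ s + 1))).symm
    _ = ∑ z : L, traceChar L (a * z ^ (2 ^ s + 1)) *
          ∑ y : L, traceChar L (y * (a * z ^ 2 ^ s + (a * z) ^ 2 ^ (3 * s))) := by
        rw [Finset.sum_comm]; simp_rw [hpol, Finset.mul_sum]
    _ = ∑ z : L, if a * z = a ^ 2 ^ s * z ^ 2 ^ (2 * s) then (2 ^ (4 * s) : ℤ) else 0 := by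
        refine Finset.sum_congr rfl fun z _ => ?_
        rw [AddChar.sum_mulShift _ traceChar_isPrimitive, hL]
        simp_rw [hrad]
        split_ifs with h
        · rw [hval z h]; push_cast; ring
        · simp
    _ = _ := by
        rw [← Finset.sum_filter, Finset.sum_const, nsmul_eq_mul, mul_comm]

/-- The exponential sum over the `n`-th roots of unity takes only two values besides the trivial
one. -/
lemma one_add_sum_traceChar [DecidableEq L] {s n : ℕ} (hs : 2 ≤ s)
    (hL : Fintype.card L = 2 ^ (4 * s))
    (hn : n = (2 ^ (2 * s) + 1) * (2 ^ s - 1)) (hn' : n * (2 ^ s + 1) = 2 ^ (4 * s) - 1)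
    {a : L} (ha0 : a ≠ 0) :
    1 + ∑ y ∈ nthRootsFinset n (1 : L), traceChar L (a * y) =
      if a ^ n = 1 then 2 ^ s - 2 ^ (2 * s) else 2 ^ s := by
  have hT := FiniteField.sum_pow_eq_mul_sum_nthRoots (hn'.trans (by rw [hL]))
    (fun y => traceChar L (a * y))
  have hsq := sq_sum_traceChar_mul_pow hL a
  simp only [mul_zero, AddChar.map_zero_eq_one] at hT
  rw [hT] at hsq
  set S := ∑ y ∈ nthRootsFinset n (1 : L), traceChar L (a * y)
  have h4 : (2 : ℤ) ^ (4 * s) = (2 ^ s) ^ 4 := by rw [← pow_mul, mul_comm]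
  have h2 : (2 : ℤ) ^ (2 * s) = (2 ^ s) ^ 2 := by rw [← pow_mul, mul_comm]
  have hq : (4 : ℤ) ≤ 2 ^ s := by
    calc (4 : ℤ) = 2 ^ 2 := by norm_num
      _ ≤ 2 ^ s := pow_le_pow_right₀ (by norm_num) hs
  -- Two candidate values of opposite sign remain; only one of them is `1` modulo `q + 1`.
  have hndvd : ∀ x : ℤ, (2 ^ s + 1) * x ≠ 2 := by
    intro x hx
    have := Int.le_of_dvd (by norm_num) (Dvd.intro _ hx)
    omega
  split_ifs with ha
  · rw [card_radical_of_pow_eq_one (by omega) hL hn' ha] at hsq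
    push_cast at hsq
    rw [h4, h2] at hsq
    rw [h2]
    generalize (2 : ℤ) ^ s = q at *
    have hq0 : q + 1 ≠ 0 := by omega
    rcases sq_eq_sq_iff_eq_or_eq_neg.1 (hsq.trans (by ring : _ = (q ^ 3) ^ 2)) with h | h
    · exact absurd (by linear_combination -h) (hndvd (q ^ 2 - q + 1 - S))
    · apply mul_left_cancel₀ hq0
      linear_combination h
  · rw [card_radical_of_pow_ne_one hL hn hn' ha0 ha] at hsq
    push_cast at hsq
    rw [h4] at hsq
    generalize (2 : ℤ) ^ s = q at *
    have hq0 : q + 1 ≠ 0 := by omega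
    rcases sq_eq_sq_iff_eq_or_eq_neg.1 (hsq.trans (by ring : _ = (q ^ 2) ^ 2)) with h | h
    · apply mul_left_cancel₀ hq0
      linear_combination h
    · exact absurd (by linear_combination -h) (hndvd (-(S + q - 1)))

end CharacterSums

/-! ### Minimum distance, sphere packing and weight enumerators -/

namespace Coding

section General

variable {F : Type*} [Field F] [DecidableEq F] {N : ℕ}

lemma hasMinDist_of_hammingNorm {C : Submodule F (Fin N → F)} {d : ℕ}
    (hd : ∃ c ∈ C, c ≠ 0 ∧ hammingNorm c = d) (h : ∀ c ∈ C, c ≠ 0 → d ≤ hammingNorm c) :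
    HasMinDist C d := by
  obtain ⟨c, hc, hc0, hcd⟩ := hd
  refine ⟨⟨c, hc, 0, C.zero_mem, hc0, by rw [hammingDist_zero_right, hcd]⟩, ?_⟩
  rintro w ⟨x, hx, y, hy, hxy, rfl⟩
  rw [hammingDist_comm, hammingDist_eq_hammingNorm]
  simpa [sub_eq_neg_add] using h (x - y) (C.sub_mem hx hy) (sub_ne_zero.2 hxy)

/-- The sphere packing argument for radius two: when there are more words `e i + e j` than cosets of
the code, two of them differ by a codeword. -/
lemma exists_hammingNorm_le_four [Fintype F] (C : Submodule F (Fin N → F))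
    (h : Fintype.card F ^ (N - Module.finrank F C) < N.choose 2) :
    ∃ c ∈ C, c ≠ 0 ∧ hammingNorm c ≤ 4 := by
  classical
  let e : Finset (Fin N) → Fin N → F := fun t i => if i ∈ t then 1 else 0
  have hcard : Fintype.card ((Fin N → F) ⧸ C) = Fintype.card F ^ (N - Module.finrank F C) := by
    rw [Module.card_eq_pow_finrank (K := F), Submodule.finrank_quotient, Module.finrank_fin_fun]
  have hlt : (Finset.univ : Finset ((Fin N → F) ⧸ C)).card <
      ((Finset.univ : Finset (Fin N)).powersetCard 2).card := by
    rwa [Finset.card_powersetCard, Finset.card_univ, Finset.card_univ, Fintype.card_fin, hcard]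
  obtain ⟨t, ht, t', ht', hne, heq⟩ := Finset.exists_ne_map_eq_of_card_lt_of_maps_to hlt
    (f := fun t => Submodule.Quotient.mk (p := C) (e t)) (fun _ _ => Finset.mem_univ _)
  refine ⟨e t - e t', (Submodule.Quotient.eq C).1 heq, fun h0 => hne ?_, ?_⟩
  · ext i
    have := congrFun (sub_eq_zero.1 h0) i
    simp only [e] at this
    split_ifs at this <;> simp_all
  · calc hammingNorm (e t - e t') ≤ (t ∪ t').card := by
          refine Finset.card_le_card fun i hi => ?_
          by_contra hit
          simp_all [e]
      _ ≤ t.card + t'.card := Finset.card_union_le _ _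
      _ = 4 := by rw [(Finset.mem_powersetCard.1 ht).2, (Finset.mem_powersetCard.1 ht').2]

lemma weightEnumerator_range {V : Type*} [AddCommGroup V] [Module F V] [Fintype V]
    {W : V →ₗ[F] (Fin N → F)} (hW : Function.Injective W) :
    weightEnumerator (LinearMap.range W) = ∑ v, (X : ℕ[X]) ^ hammingNorm (W v) := by
  classical
  have hmaps : ∀ v ∈ (Finset.univ : Finset V), hammingNorm (W v) ∈ Finset.range (N + 1) := by
    intro v _
    have := hammingNorm_le_card_fintype (x := W v)
    rw [Fintype.card_fin] at this
    exact Finset.mem_range.2 (Nat.lt_succ_of_le this)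
  rw [weightEnumerator, ← Finset.sum_fiberwise_of_maps_to hmaps]
  refine Finset.sum_congr rfl fun j _ => ?_
  rw [Finset.sum_congr rfl (g := fun _ => (X : ℕ[X]) ^ j)
    (fun v hv => by rw [(Finset.mem_filter.1 hv).2]), Finset.sum_const, nsmul_eq_mul]
  congr 1
  have : {c : Fin N → F | c ∈ LinearMap.range W ∧ hammingNorm c = j} =
      W '' (Finset.univ.filter fun v => hammingNorm (W v) = j : Finset V) := by
    ext c
    constructor
    · rintro ⟨⟨v, rfl⟩, h⟩
      exact ⟨v, by simpa using h, rfl⟩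
    · rintro ⟨v, hv, rfl⟩
      exact ⟨⟨v, rfl⟩, by simpa using hv⟩
  rw [weightCount, this, Set.ncard_image_of_injective _ hW, Set.ncard_coe_finset]
  simp

end General

section Binary

lemma sum_signChar {ι : Type*} [Fintype ι] (c : ι → ZMod 2) :
    ∑ i, signChar (c i) = Fintype.card ι - 2 * hammingNorm c := by
  have h : ∀ x : ZMod 2, signChar x = 1 - 2 * (if x ≠ 0 then 1 else 0) := by decide
  simp_rw [h]
  rw [Finset.sum_sub_distrib, ← Finset.mul_sum, Finset.sum_boole]
  simp [hammingNorm]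

lemma natCast_hammingNorm {ι : Type*} [Fintype ι] (c : ι → ZMod 2) :
    (hammingNorm c : ZMod 2) = ∑ i, c i := by
  have h : ∀ x : ZMod 2, x = if x ≠ 0 then 1 else 0 := by decide
  conv_rhs => rw [Finset.sum_congr rfl fun i _ => h (c i), Finset.sum_boole]
  rfl

end Binary

/-! ### Codes given by a list of locators, and their duals -/

section Locators

variable {L : Type*} [Field L] [Algebra (ZMod 2) L] {N : ℕ}

/-- The map `c ↦ (∑ c i * u i, ∑ c i)`, whose kernel is the even-weight code with locators `u i`:
its parity check matrix has the columns `(u i, 1)`. -/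
noncomputable def parityCheck (u : Fin N → L) : (Fin N → ZMod 2) →ₗ[ZMod 2] L × ZMod 2 :=
  (Fintype.linearCombination (ZMod 2) u).prod (Fintype.linearCombination (ZMod 2) fun _ => 1)

lemma parityCheck_apply (u : Fin N → L) (c : Fin N → ZMod 2) :
    parityCheck u c = (∑ i, c i • u i, ∑ i, c i) := by
  simp [parityCheck, Fintype.linearCombination_apply]

lemma mem_ker_parityCheck {u : Fin N → L} {c : Fin N → ZMod 2} :
    c ∈ LinearMap.ker (parityCheck u) ↔ ∑ i, c i • u i = 0 ∧ ∑ i, c i = 0 := by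
  rw [LinearMap.mem_ker, parityCheck_apply, Prod.mk_eq_zero]

/-- The words `i ↦ Tr (a * u i) + b`, as a linear function of `(a, b)`. -/
noncomputable def traceWord (u : Fin N → L) : L × ZMod 2 →ₗ[ZMod 2] (Fin N → ZMod 2) :=
  LinearMap.pi fun i =>
    (Algebra.trace (ZMod 2) L ∘ₗ LinearMap.mulRight (ZMod 2) (u i)).coprod LinearMap.id

lemma traceWord_apply (u : Fin N → L) (a : L) (b : ZMod 2) (i : Fin N) :
    traceWord u (a, b) i = Algebra.trace (ZMod 2) L (a * u i) + b := by
  simp [traceWord]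

/-- A word of even weight less than four would have weight two, and would force two locators to
coincide. -/
lemma four_le_hammingNorm_of_mem_ker {u : Fin N → L} (hu : Function.Injective u)
    {c : Fin N → ZMod 2} (hc : c ∈ LinearMap.ker (parityCheck u)) (hc0 : c ≠ 0) :
    4 ≤ hammingNorm c := by
  obtain ⟨h1, h2⟩ := mem_ker_parityCheck.1 hc
  rw [← natCast_hammingNorm, ZMod.natCast_eq_zero_iff] at h2
  have hpos : 0 < hammingNorm c := hammingNorm_pos_iff.2 hc0
  by_contra! hlt
  have htwo : hammingNorm c = 2 := by omega
  obtain ⟨i, j, hij, hs⟩ := Finset.card_eq_two.1 htwo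
  have hone : ∀ x : ZMod 2, x ≠ 0 → x = 1 := by decide
  have hsum : ∑ k, c k • u k = u i + u j := by
    rw [← Finset.sum_subset (Finset.subset_univ ({i, j} : Finset (Fin N))), Finset.sum_pair hij]
    · have hi : c i ≠ 0 := by
        have : i ∈ ({i, j} : Finset (Fin N)) := by simp
        rw [← hs] at this; simpa using this
      have hj : c j ≠ 0 := by
        have : j ∈ ({i, j} : Finset (Fin N)) := by simp
        rw [← hs] at this; simpa using this
      rw [hone _ hi, hone _ hj, one_smul, one_smul]
    · intro k _ hk
      rw [← hs] at hk
      have : c k = 0 := by simpa using hk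
      rw [this, zero_smul]
  have : CharP L 2 := charP_of_injective_algebraMap (algebraMap (ZMod 2) L).injective 2
  rw [hsum, CharTwo.add_eq_zero] at h1
  exact hij (hu h1)

lemma card_sub_two_mul_hammingNorm_traceWord (u : Fin N → L) (a : L) (b : ZMod 2) :
    (N : ℤ) - 2 * hammingNorm (traceWord u (a, b)) =
      signChar b * ∑ i, traceChar L (a * u i) := by
  have h := sum_signChar (traceWord u (a, b))
  rw [Fintype.card_fin] at h
  rw [← h, Finset.mul_sum]
  refine Finset.sum_congr rfl fun i _ => ?_
  rw [traceWord_apply, AddChar.map_add_eq_mul, mul_comm, traceChar_apply]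

variable [Finite L]

/-- Nondegeneracy of the trace form identifies the linear functionals on `L × ZMod 2`. -/
lemma exists_dual_eq_trace (f : Module.Dual (ZMod 2) (L × ZMod 2)) :
    ∃ (a : L) (b : ZMod 2), ∀ x y, f (x, y) = Algebra.trace (ZMod 2) L (a * x) + b * y := by
  obtain ⟨a, ha⟩ := ((Algebra.traceForm (ZMod 2) L).toDual
    (traceForm_nondegenerate (ZMod 2) L)).surjective (f ∘ₗ LinearMap.inl (ZMod 2) L (ZMod 2))
  refine ⟨a, f (0, 1), fun x y => ?_⟩
  have h1 : Algebra.trace (ZMod 2) L (a * x) = f (x, 0) := by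
    have := LinearMap.congr_fun ha x
    rwa [LinearMap.BilinForm.toDual_def, Algebra.traceForm_apply] at this
  have h2 : f (0, 1) * y = f (0, y) := by
    rw [mul_comm, ← smul_eq_mul, ← map_smul]; simp
  rw [h1, h2, ← map_add]
  simp

lemma dualCode_ker_parityCheck (u : Fin N → L) :
    dualCode (LinearMap.ker (parityCheck u)) = LinearMap.range (traceWord u) := by
  ext w
  constructor
  · intro hw
    have hmem : (∑ i, w i • (LinearMap.proj i : (Fin N → ZMod 2) →ₗ[ZMod 2] ZMod 2)) ∈
        LinearMap.range (parityCheck u).dualMap := by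
      rw [LinearMap.range_dualMap_eq_dualAnnihilator_ker, Submodule.mem_dualAnnihilator]
      intro c hc
      simpa using hw c hc
    obtain ⟨f, hf⟩ := hmem
    obtain ⟨a, b, hab⟩ := exists_dual_eq_trace f
    refine ⟨(a, b), funext fun i => ?_⟩
    have := LinearMap.congr_fun hf (Pi.single i 1)
    rw [LinearMap.dualMap_apply, parityCheck_apply, hab] at this
    simpa [Pi.single_apply, traceWord_apply] using this
  · rintro ⟨⟨a, b⟩, rfl⟩ c hc
    obtain ⟨h1, h2⟩ := mem_ker_parityCheck.1 hc
    have h : ∀ i, traceWord u (a, b) i * c i =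
        Algebra.trace (ZMod 2) L (a * (c i • u i)) + b * c i := by
      intro i
      rw [traceWord_apply, mul_smul_comm, map_smul, smul_eq_mul]; ring
    simp_rw [h]
    rw [Finset.sum_add_distrib, ← map_sum, ← Finset.mul_sum, ← Finset.mul_sum, h1, h2]
    simp

lemma finrank_ker_parityCheck {u : Fin N → L} (hu : Function.Injective (traceWord u)) :
    Module.finrank (ZMod 2) (LinearMap.ker (parityCheck u)) =
      N - (Module.finrank (ZMod 2) L + 1) := by
  have hsurj : Function.Surjective (parityCheck u) := by
    rw [← LinearMap.dualMap_injective_iff, injective_iff_map_eq_zero]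
    intro f hf
    obtain ⟨a, b, hab⟩ := exists_dual_eq_trace f
    have h0 : traceWord u (a, b) = 0 := funext fun i => by
      have := LinearMap.congr_fun hf (Pi.single i 1)
      rw [LinearMap.dualMap_apply, parityCheck_apply, hab] at this
      simpa [Pi.single_apply, traceWord_apply] using this
    have h := hu (h0.trans (map_zero _).symm)
    rw [Prod.mk_eq_zero] at h
    refine LinearMap.ext fun p => ?_
    rw [← Prod.mk.eta (p := p), hab, h.1, h.2]
    simp
  have h := LinearMap.finrank_range_add_finrank_ker (parityCheck u)
  rw [LinearMap.range_eq_top.2 hsurj, finrank_top, Module.finrank_prod, Module.finrank_self,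
    Module.finrank_fin_fun] at h
  omega

lemma finrank_range_traceWord {u : Fin N → L} (hu : Function.Injective (traceWord u)) :
    Module.finrank (ZMod 2) (LinearMap.range (traceWord u)) = Module.finrank (ZMod 2) L + 1 := by
  rw [LinearMap.finrank_range_of_inj hu, Module.finrank_prod, Module.finrank_self]

end Locators

/-! ### The BCH code and its extension -/

section BCH

variable {K : Type*} [Field K] {n : ℕ}

/-- The powers of `β` followed by zero. -/
def locators (β : K) (n : ℕ) : Fin (n + 1) → K := Fin.snoc (fun i : Fin n => β ^ (i : ℕ)) 0

lemma locators_castSucc (β : K) (i : Fin n) : locators β n i.castSucc = β ^ (i : ℕ) := by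
  simp [locators]

lemma locators_last (β : K) : locators β n (Fin.last n) = 0 := by
  simp [locators]

lemma locators_injective {β : K} (hβ : IsPrimitiveRoot β n) :
    Function.Injective (locators β n) := by
  intro i j
  induction i using Fin.lastCases with
  | last =>
    induction j using Fin.lastCases with
    | last => simp
    | cast j =>
      rw [locators_last, locators_castSucc]
      exact fun h => absurd h.symm (pow_ne_zero _ (hβ.ne_zero (Fin.pos j).ne'))
  | cast i =>
    induction j using Fin.lastCases with
    | last =>
      rw [locators_last, locators_castSucc]
      exact fun h => absurd h (pow_ne_zero _ (hβ.ne_zero (Fin.pos i).ne'))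
    | cast j =>
      rw [locators_castSucc, locators_castSucc]
      intro h
      rw [Fin.ext (hβ.pow_inj i.2 j.2 h)]

variable [Algebra (ZMod 2) K]

lemma mem_cyclicCode {F : Type*} [Field F] {g : F[X]} (hg : g ∣ X ^ n - 1) {c : Fin n → F} :
    c ∈ cyclicCode n g ↔ g ∣ ∑ i : Fin n, monomial (i : ℕ) (c i) := by
  have h : toCyclicRing F n c =
      Ideal.Quotient.mk (Ideal.span {(X ^ n - 1 : F[X])}) (∑ i : Fin n, monomial (i : ℕ) (c i)) := by
    simp [toCyclicRing]
  rw [cyclicCode, Submodule.mem_comap, Submodule.restrictScalars_mem, h]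
  rw [Ideal.mem_span_singleton]
  constructor
  · rintro ⟨r, hr⟩
    obtain ⟨r, rfl⟩ := Ideal.Quotient.mk_surjective r
    rw [← map_mul, Ideal.Quotient.eq, Ideal.mem_span_singleton] at hr
    exact (dvd_sub_left (Dvd.intro r rfl)).1 (hg.trans hr)
  · exact fun h => map_dvd _ h

/-- The conjugate `β ^ 2` imposes no condition beyond the one imposed by `β`. -/
lemma mem_bchCode_iff {β : K} (hβ : β ^ n = 1) {c : Fin n → ZMod 2} :
    c ∈ bchCode (ZMod 2) β n 3 1 ↔ ∑ i, c i • β ^ (i : ℕ) = 0 := by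
  have : CharP K 2 := charP_of_injective_algebraMap (algebraMap (ZMod 2) K).injective 2
  have hgen : ∀ p : (ZMod 2)[X], bchGenerator (ZMod 2) β 3 1 ∣ p ↔
      ∀ j ∈ Finset.range 2, minpoly (ZMod 2) (β ^ ((1 : ℤ) + (j : ℤ))) ∣ p := by
    intro p
    rw [bchGenerator]
    exact @Finset.lcm_dvd_iff _ _ _ (_) _ _ _
  have hdvd : bchGenerator (ZMod 2) β 3 1 ∣ X ^ n - 1 := by
    rw [hgen]
    intro j _
    rw [minpoly.dvd_iff]
    simp only [map_sub, map_pow, aeval_X, map_one]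
    rw [← zpow_natCast, ← zpow_mul, mul_comm, zpow_mul, zpow_natCast, hβ, one_zpow, sub_self]
  rw [bchCode, mem_cyclicCode hdvd, hgen]
  have haeval : ∀ γ : K, aeval γ (∑ i : Fin n, monomial (i : ℕ) (c i)) =
      ∑ i, c i • γ ^ (i : ℕ) := by
    intro γ
    simp [aeval_monomial, Algebra.smul_def]
  constructor
  · intro h
    have := h 0 (by simp)
    rwa [minpoly.dvd_iff, haeval, Nat.cast_zero, add_zero, zpow_one] at this
  · intro h j hj
    rw [minpoly.dvd_iff, haeval]
    rw [Finset.mem_range] at hj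
    interval_cases j
    · simpa using h
    · have hsq := congrArg (frobenius K 2) h
      rw [map_sum, map_zero] at hsq
      rw [← hsq]
      refine Finset.sum_congr rfl fun i _ => ?_
      have hc : ∀ x : ZMod 2, x ^ 2 = x := by decide
      rw [frobenius_def, Algebra.smul_def, Algebra.smul_def, mul_pow, ← map_pow, hc, ← pow_mul,
        mul_comm (i : ℕ) 2, pow_mul]
      norm_cast

lemma extendedCode_bchCode {β : K} (hβ : β ^ n = 1) :
    extendedCode (bchCode (ZMod 2) β n 3 1) = LinearMap.ker (parityCheck (locators β n)) := by
  ext x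
  rw [mem_ker_parityCheck, Fin.sum_univ_castSucc, Fin.sum_univ_castSucc]
  simp_rw [locators_castSucc, locators_last]
  rw [smul_zero, add_zero, ← mem_bchCode_iff (c := fun i => x i.castSucc) hβ, add_eq_zero_iff_neg_eq,
    eq_comm (b := x (Fin.last n))]
  rfl

/-- The code only depends on the minimal polynomial of `β`, so `β` may be replaced by a root of that
polynomial in any field that has a primitive `n`-th root of unity. -/
lemma exists_isPrimitiveRoot_bchCode_eq (hn : 0 < n) {β : K} (hβ : IsPrimitiveRoot β n)
    {L : Type*} [Field L] [Algebra (ZMod 2) L] {ζ : L} (hζ : IsPrimitiveRoot ζ n) :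
    ∃ γ : L, IsPrimitiveRoot γ n ∧ bchCode (ZMod 2) β n 3 1 = bchCode (ZMod 2) γ n 3 1 := by
  have hint : IsIntegral (ZMod 2) β := by
    refine ⟨X ^ n - 1, monic_X_pow_sub_C 1 hn.ne', ?_⟩
    simp [hβ.pow_eq_one]
  have hdvd : minpoly (ZMod 2) β ∣ X ^ n - 1 := by
    rw [minpoly.dvd_iff]; simp [hβ.pow_eq_one]
  have hsplit : ((minpoly (ZMod 2) β).map (algebraMap (ZMod 2) L)).Splits := by
    refine (X_pow_sub_one_splits hζ).of_dvd (monic_X_pow_sub_C 1 hn.ne').ne_zero ?_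
    simpa using map_dvd (mapRingHom (algebraMap (ZMod 2) L)) hdvd
  obtain ⟨γ, hγ⟩ := hsplit.exists_eval_eq_zero (by
    rw [degree_map]; exact (minpoly.degree_pos hint).ne')
  rw [eval_map_algebraMap] at hγ
  have hmin : minpoly (ZMod 2) β = minpoly (ZMod 2) γ :=
    minpoly.eq_of_irreducible_of_monic (minpoly.irreducible hint) hγ (minpoly.monic hint)
  have haeval : ∀ p : (ZMod 2)[X], aeval β p = 0 ↔ aeval γ p = 0 := by
    intro p
    rw [← minpoly.dvd_iff, hmin, minpoly.dvd_iff]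
  have hpow : ∀ k, β ^ k = 1 ↔ γ ^ k = 1 := by
    intro k
    have h := haeval (X ^ k - 1)
    simp only [map_sub, map_pow, aeval_X, map_one, sub_eq_zero] at h
    exact h
  have hγn : γ ^ n = 1 := (hpow n).1 hβ.pow_eq_one
  refine ⟨γ, ⟨hγn, fun k hk => hβ.dvd_of_pow_eq_one k ((hpow k).2 hk)⟩, ?_⟩
  ext c
  rw [mem_bchCode_iff hβ.pow_eq_one, mem_bchCode_iff hγn]
  simpa [aeval_monomial, Algebra.smul_def] using haeval (∑ i : Fin n, monomial (i : ℕ) (c i))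

end BCH

end Coding

/-! ### The parameters -/

namespace Coding

section Parameters

variable {s n : ℕ}

lemma length_mul (hn : n = (2 ^ (2 * s) + 1) * (2 ^ s - 1)) :
    n * (2 ^ s + 1) = 2 ^ (4 * s) - 1 := by
  have h4 : 2 ^ (4 * s) = (2 ^ s) ^ 4 := by rw [← pow_mul, mul_comm]
  have h2 : 2 ^ (2 * s) = (2 ^ s) ^ 2 := by rw [← pow_mul, mul_comm]
  obtain ⟨m, hm⟩ : ∃ m, 2 ^ s = m + 1 := ⟨_, (Nat.succ_pred (by positivity)).symm⟩
  rw [hn, h4, h2, hm, Nat.add_sub_cancel]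
  refine (Nat.sub_eq_of_eq_add ?_).symm
  ring

/-- The linear relations between `n` and the powers of two in the weights. -/
lemma length_relations (hs : 2 ≤ s) (hn : n = (2 ^ (2 * s) + 1) * (2 ^ s - 1)) :
    4 ≤ 2 ^ s ∧ 2 * 2 ^ s ≤ 2 ^ (2 * s - 1) ∧ 4 * 2 ^ (2 * s - 1) ≤ 2 ^ (3 * s - 1) ∧
      2 * 2 ^ (2 * s - 1) = 2 ^ (2 * s) ∧
      n + 1 + 2 * 2 ^ (2 * s - 1) = 2 * 2 ^ (3 * s - 1) + 2 ^ s := by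
  have h4 : (2 : ℕ) ^ 2 ≤ 2 ^ s := Nat.pow_le_pow_right (by norm_num) hs
  have h2 : 2 * 2 ^ (2 * s - 1) = 2 ^ (2 * s) := by
    rw [← pow_succ', Nat.sub_add_cancel (by omega)]
  have h3 : 2 * 2 ^ (3 * s - 1) = 2 ^ (3 * s) := by
    rw [← pow_succ', Nat.sub_add_cancel (by omega)]
  refine ⟨h4, ?_, ?_, h2, ?_⟩
  · rw [← pow_succ']; exact Nat.pow_le_pow_right (by norm_num) (by omega)
  · calc 4 * 2 ^ (2 * s - 1) = 2 ^ (2 + (2 * s - 1)) := by rw [pow_add]; norm_num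
      _ ≤ _ := Nat.pow_le_pow_right (by norm_num) (by omega)
  · have e3 : 2 ^ (3 * s) = (2 ^ s) ^ 3 := by rw [← pow_mul, mul_comm]
    have e2 : 2 ^ (2 * s) = (2 ^ s) ^ 2 := by rw [← pow_mul, mul_comm]
    obtain ⟨m, hm⟩ : ∃ m, 2 ^ s = m + 1 := ⟨_, (Nat.succ_pred (by positivity)).symm⟩
    rw [h2, h3, hn, e3, e2, hm, Nat.add_sub_cancel]
    ring

lemma three_mul_lt_length (hs : 2 ≤ s) (hn : n = (2 ^ (2 * s) + 1) * (2 ^ s - 1)) :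
    3 * 2 ^ (2 * s) < n := by
  obtain ⟨h, -⟩ := length_relations hs hn
  obtain ⟨m, hm⟩ : ∃ m, 2 ^ s = m + 4 := Nat.exists_eq_add_of_le' h
  have : 0 < 2 ^ (2 * s) := by positivity
  rw [hn, hm, Nat.add_sub_assoc (by norm_num)]
  nlinarith

lemma four_mul_lt_length (hs : 2 ≤ s) (hn : n = (2 ^ (2 * s) + 1) * (2 ^ s - 1)) : 4 * s < n := by
  have h1 := three_mul_lt_length hs hn
  have h2 : 2 * s < 2 ^ (2 * s) := Nat.lt_two_pow_self
  omega

lemma two_pow_lt_choose (hs : 2 ≤ s) (hn : n = (2 ^ (2 * s) + 1) * (2 ^ s - 1)) :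
    2 ^ (4 * s + 1) < (n + 1).choose 2 := by
  have h1 := three_mul_lt_length hs hn
  have h4 : 2 ^ (4 * s) = 2 ^ (2 * s) * 2 ^ (2 * s) := by rw [← pow_add]; congr 1; ring
  have : 0 < 2 ^ (2 * s) := by positivity
  rw [Nat.choose_two_right, Nat.add_sub_cancel, Nat.lt_iff_add_one_le, Nat.le_div_iff_mul_le two_pos,
    pow_succ, h4]
  nlinarith

end Parameters

/-! ### The extended code and its dual over the field with `2 ^ (4 * s)` elements -/

section Main

variable {L : Type*} [Field L] [Fintype L] {s n : ℕ} {β : L}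

/-- The number of `a` other than zero and the `n`-th roots of unity. -/
lemma card_compl_insert_zero_nthRootsFinset [DecidableEq L] (hpos : 0 < n)
    (hL : Fintype.card L = 2 ^ (4 * s)) (hβ : IsPrimitiveRoot β n) :
    ((insert 0 (nthRootsFinset n (1 : L)))ᶜ : Finset L).card = 2 ^ (4 * s) - 1 - n := by
  rw [Finset.card_compl, Finset.card_insert_of_notMem, hβ.card_nthRootsFinset, hL]
  · omega
  · rw [Polynomial.mem_nthRootsFinset hpos, zero_pow hpos.ne']; exact zero_ne_one

variable [Algebra (ZMod 2) L]

lemma finrank_eq (hL : Fintype.card L = 2 ^ (4 * s)) : Module.finrank (ZMod 2) L = 4 * s := by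
  have := Module.card_eq_pow_finrank (K := ZMod 2) (V := L)
  rw [hL, ZMod.card] at this
  exact (Nat.pow_right_injective le_rfl this).symm

/-- The Hamming weight of `traceWord (locators β n) (a, b)`. -/
lemma hammingNorm_traceWord_locators [DecidableEq L] (hs : 2 ≤ s)
    (hL : Fintype.card L = 2 ^ (4 * s))
    (hn : n = (2 ^ (2 * s) + 1) * (2 ^ s - 1)) (hβ : IsPrimitiveRoot β n) (a : L) (b : ZMod 2) :
    hammingNorm (traceWord (locators β n) (a, b)) =
      if a = 0 then (if b = 0 then 0 else n + 1)
      else if a ^ n = 1 then (if b = 0 then 2 ^ (3 * s - 1) else n + 1 - 2 ^ (3 * s - 1))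
      else if b = 0 then 2 ^ (3 * s - 1) - 2 ^ (2 * s - 1)
        else n + 1 - 2 ^ (3 * s - 1) + 2 ^ (2 * s - 1) := by
  have : CharP L 2 := charP_of_injective_algebraMap (algebraMap (ZMod 2) L).injective 2
  obtain ⟨h1, h2, h3, h4, h5⟩ := length_relations hs hn
  have h := card_sub_two_mul_hammingNorm_traceWord (locators β n) a b
  have hpos : 0 < n := (Nat.zero_le _).trans_lt (four_mul_lt_length hs hn)
  have hsum : ∑ i, traceChar L (a * locators β n i) =
      1 + ∑ y ∈ nthRootsFinset n (1 : L), traceChar L (a * y) := by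
    rw [Fin.sum_univ_castSucc]
    simp_rw [locators_castSucc, locators_last]
    rw [mul_zero, AddChar.map_zero_eq_one, add_comm,
      ← hβ.sum_range_eq_sum_nthRootsFinset hpos (fun y => traceChar L (a * y)),
      Fin.sum_univ_eq_sum_range (fun i => traceChar L (a * β ^ i))]
  rw [hsum] at h
  have hb : b = 0 ∨ b = 1 := (by decide : ∀ b : ZMod 2, b = 0 ∨ b = 1) b
  have h4' : (2 : ℤ) ^ (2 * s) = 2 * ((2 ^ (2 * s - 1) : ℕ) : ℤ) := by exact_mod_cast h4.symm
  have hq : (2 : ℤ) ^ s = ((2 ^ s : ℕ) : ℤ) := by push_cast; rfl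
  by_cases ha : a = 0
  · simp only [ha, zero_mul, AddChar.map_zero_eq_one, Finset.sum_const, hβ.card_nthRootsFinset,
      nsmul_eq_mul, mul_one, if_true] at h ⊢
    rcases hb with rfl | rfl
    · rw [signChar_zero] at h
      rw [if_pos rfl]
      push_cast at h
      omega
    · rw [signChar_one] at h
      rw [if_neg one_ne_zero]
      push_cast at h
      omega
  · rw [one_add_sum_traceChar hs hL hn (length_mul hn) ha, h4', hq] at h
    rw [if_neg ha]
    rcases hb with rfl | rfl
    · rw [signChar_zero] at h
      simp only [if_true]
      split_ifs at h ⊢ <;> omega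
    · rw [signChar_one] at h
      simp only [one_ne_zero, if_false]
      split_ifs at h ⊢ <;> omega

lemma traceWord_locators_injective (hs : 2 ≤ s) (hL : Fintype.card L = 2 ^ (4 * s))
    (hn : n = (2 ^ (2 * s) + 1) * (2 ^ s - 1)) (hβ : IsPrimitiveRoot β n) :
    Function.Injective (traceWord (locators β n)) := by
  classical
  rw [injective_iff_map_eq_zero]
  rintro ⟨a, b⟩ h
  have hw := hammingNorm_traceWord_locators hs hL hn hβ a b
  obtain ⟨h1, h2, h3, h4, h5⟩ := length_relations hs hn
  rw [h, hammingNorm_zero] at hw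
  split_ifs at hw with ha hb
  · rw [ha, hb]; rfl
  all_goals omega

lemma hasParameters_ker_parityCheck (hs : 2 ≤ s) (hL : Fintype.card L = 2 ^ (4 * s))
    (hn : n = (2 ^ (2 * s) + 1) * (2 ^ s - 1)) (hβ : IsPrimitiveRoot β n) :
    HasParameters (LinearMap.ker (parityCheck (locators β n))) (n - 4 * s) 4 := by
  have hlt := four_mul_lt_length hs hn
  have hfin : Module.finrank (ZMod 2) (LinearMap.ker (parityCheck (locators β n))) =
      n - 4 * s := by
    rw [finrank_ker_parityCheck (traceWord_locators_injective hs hL hn hβ), finrank_eq hL]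
    omega
  have hmin : ∀ c ∈ LinearMap.ker (parityCheck (locators β n)), c ≠ 0 → 4 ≤ hammingNorm c :=
    fun c hc hc0 => four_le_hammingNorm_of_mem_ker (locators_injective hβ) hc hc0
  refine ⟨hfin, hasMinDist_of_hammingNorm ?_ hmin⟩
  obtain ⟨c, hc, hc0, hle⟩ := exists_hammingNorm_le_four
    (LinearMap.ker (parityCheck (locators β n))) (by
      rw [hfin, ZMod.card, show n + 1 - (n - 4 * s) = 4 * s + 1 by omega]
      exact two_pow_lt_choose hs hn)
  exact ⟨c, hc, hc0, hle.antisymm (hmin c hc hc0)⟩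

lemma isDistanceOptimalForSpherePacking_of_hasParameters (hs : 2 ≤ s)
    (hn : n = (2 ^ (2 * s) + 1) * (2 ^ s - 1)) {C : Submodule (ZMod 2) (Fin (n + 1) → ZMod 2)}
    (hC : HasParameters C (n - 4 * s) 4) : IsDistanceOptimalForSpherePacking C := by
  have hlt := four_mul_lt_length hs hn
  have hcodim : n + 1 - (n - 4 * s) = 4 * s + 1 := by omega
  refine ⟨⟨n - 4 * s, 4, hC, ?_⟩, ⟨n - 4 * s, 4, hC, ?_⟩⟩
  · rintro ⟨D, d', hd', hfin, hmin⟩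
    obtain ⟨c, hc, hc0, hle⟩ := exists_hammingNorm_le_four D (by
      rw [hfin, ZMod.card, hcodim]
      exact two_pow_lt_choose hs hn)
    have := hmin.2 ⟨c, hc, 0, D.zero_mem, hc0, rfl⟩
    rw [hammingDist_zero_right] at this
    omega
  · intro d' hd' h
    rw [SpherePackingBound, Nat.card_zmod, hcodim] at h
    have h2 : 2 ∈ Finset.range ((d' - 1) / 2 + 1) := by
      rw [Finset.mem_range]; omega
    have hle := Finset.single_le_sum (f := fun i => (n + 1).choose i * (2 - 1) ^ i)
      (fun _ _ => Nat.zero_le _) h2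
    have := two_pow_lt_choose hs hn
    simp only [Nat.add_one_sub_one, one_pow, mul_one] at hle h
    omega

lemma length_lt (hs : 2 ≤ s) (hn : n = (2 ^ (2 * s) + 1) * (2 ^ s - 1)) :
    n < 2 ^ (4 * s) - 1 := by
  have hlt := four_mul_lt_length hs hn
  obtain ⟨h1, -⟩ := length_relations hs hn
  rw [← length_mul hn]
  nlinarith

lemma weightEnumerator_range_traceWord (hs : 2 ≤ s) (hL : Fintype.card L = 2 ^ (4 * s))
    (hn : n = (2 ^ (2 * s) + 1) * (2 ^ s - 1)) (hβ : IsPrimitiveRoot β n) :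
    weightEnumerator (LinearMap.range (traceWord (locators β n))) =
      1 + Polynomial.C n * X ^ (n + 1 - 2 ^ (3 * s - 1))
        + Polynomial.C (2 ^ (4 * s) - 1 - n) * X ^ (2 ^ (3 * s - 1) - 2 ^ (2 * s - 1))
        + Polynomial.C (2 ^ (4 * s) - 1 - n) *
            X ^ (n + 1 - 2 ^ (3 * s - 1) + 2 ^ (2 * s - 1))
        + Polynomial.C n * X ^ (2 ^ (3 * s - 1)) + X ^ (n + 1) := by
  classical
  have hpos : 0 < n := (Nat.zero_le _).trans_lt (four_mul_lt_length hs hn)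
  have h0 : (0 : L) ∉ nthRootsFinset n (1 : L) := by
    rw [Polynomial.mem_nthRootsFinset hpos, zero_pow hpos.ne']; exact zero_ne_one
  rw [weightEnumerator_range (traceWord_locators_injective hs hL hn hβ), Fintype.sum_prod_type]
  have hb : ∀ f : ZMod 2 → ℕ[X], ∑ b, f b = f 0 + f 1 := fun f => Fin.sum_univ_two f
  simp_rw [hb, hammingNorm_traceWord_locators hs hL hn hβ, if_pos, if_neg (one_ne_zero' (ZMod 2))]
  rw [← Finset.sum_add_sum_compl (insert 0 (nthRootsFinset n (1 : L))), Finset.sum_insert h0]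
  have hroots : ∀ a ∈ nthRootsFinset n (1 : L), a ≠ 0 ∧ a ^ n = 1 := fun a ha =>
    ⟨ne_of_mem_of_not_mem ha h0, (Polynomial.mem_nthRootsFinset hpos 1).1 ha⟩
  have hrest : ∀ a ∈ ((insert 0 (nthRootsFinset n (1 : L)))ᶜ : Finset L), a ≠ 0 ∧ a ^ n ≠ 1 := by
    intro a ha
    rw [Finset.mem_compl, Finset.mem_insert, Polynomial.mem_nthRootsFinset hpos] at ha
    tauto
  rw [Finset.sum_congr rfl (s₁ := nthRootsFinset n (1 : L))
      (g := fun _ => X ^ 2 ^ (3 * s - 1) + X ^ (n + 1 - 2 ^ (3 * s - 1)))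
      (fun a ha => by simp only [if_neg (hroots a ha).1, if_pos (hroots a ha).2]),
    Finset.sum_congr rfl (s₁ := (insert 0 (nthRootsFinset n (1 : L)))ᶜ)
      (g := fun _ => X ^ (2 ^ (3 * s - 1) - 2 ^ (2 * s - 1)) +
        X ^ (n + 1 - 2 ^ (3 * s - 1) + 2 ^ (2 * s - 1)))
      (fun a ha => by simp only [if_neg (hrest a ha).1, if_neg (hrest a ha).2]),
    Finset.sum_const, Finset.sum_const, hβ.card_nthRootsFinset,
    card_compl_insert_zero_nthRootsFinset hpos hL hβ]
  simp only [if_true, pow_zero, nsmul_eq_mul, ← C_eq_natCast]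
  push_cast
  ring

lemma setOf_weights_range_traceWord (hs : 2 ≤ s) (hL : Fintype.card L = 2 ^ (4 * s))
    (hn : n = (2 ^ (2 * s) + 1) * (2 ^ s - 1)) (hβ : IsPrimitiveRoot β n) :
    {w | ∃ c ∈ LinearMap.range (traceWord (locators β n)), c ≠ 0 ∧ hammingNorm c = w} =
      ({n + 1 - 2 ^ (3 * s - 1), 2 ^ (3 * s - 1) - 2 ^ (2 * s - 1),
        n + 1 - 2 ^ (3 * s - 1) + 2 ^ (2 * s - 1), 2 ^ (3 * s - 1), n + 1} : Finset ℕ) := by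
  classical
  have hinj := traceWord_locators_injective hs hL hn hβ
  have hw := hammingNorm_traceWord_locators hs hL hn hβ
  have hpos : 0 < n := (Nat.zero_le _).trans_lt (four_mul_lt_length hs hn)
  have hmem : ∀ (a : L) (b : ZMod 2), (a, b) ≠ 0 →
      ∃ c ∈ LinearMap.range (traceWord (locators β n)), c ≠ 0 ∧
        hammingNorm c = hammingNorm (traceWord (locators β n) (a, b)) := fun a b hab =>
    ⟨_, ⟨(a, b), rfl⟩, fun h => hab (hinj (h.trans (map_zero _).symm)), rfl⟩
  obtain ⟨a, ha⟩ : ((insert 0 (nthRootsFinset n (1 : L)))ᶜ : Finset L).Nonempty := by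
    rw [← Finset.card_pos, card_compl_insert_zero_nthRootsFinset hpos hL hβ]
    exact Nat.sub_pos_of_lt (length_lt hs hn)
  rw [Finset.mem_compl, Finset.mem_insert, Polynomial.mem_nthRootsFinset hpos, not_or] at ha
  obtain ⟨ha0, han⟩ := ha
  ext w
  simp only [Set.mem_ofPred_eq, Finset.coe_insert, Finset.coe_singleton, Set.mem_insert_iff,
    Set.mem_singleton_iff]
  constructor
  · rintro ⟨_, ⟨⟨a, b⟩, rfl⟩, hc0, rfl⟩
    have hne : ¬ (a = 0 ∧ b = 0) := by
      rintro ⟨rfl, rfl⟩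
      exact hc0 (map_zero _)
    rw [hw]
    split_ifs with ha hb
    · exact absurd ⟨ha, hb⟩ hne
    all_goals simp only [true_or, or_true]
  · have h10 : (1 : ZMod 2) ≠ 0 := one_ne_zero
    rintro (rfl | rfl | rfl | rfl | rfl)
    · simpa [hw] using hmem 1 1 (by simp)
    · simpa [hw, ha0, han] using hmem a 0 (by simp [ha0])
    · simpa [hw, ha0, han] using hmem a 1 (by simp)
    · simpa [hw] using hmem 1 0 (by simp)
    · simpa [hw] using hmem 0 1 (by simp)

lemma isWeightCode_five_range_traceWord (hs : 2 ≤ s) (hL : Fintype.card L = 2 ^ (4 * s))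
    (hn : n = (2 ^ (2 * s) + 1) * (2 ^ s - 1)) (hβ : IsPrimitiveRoot β n) :
    IsWeightCode 5 (LinearMap.range (traceWord (locators β n))) := by
  obtain ⟨h1, h2, h3, h4, h5⟩ := length_relations hs hn
  rw [IsWeightCode, setOf_weights_range_traceWord hs hL hn hβ, Set.ncard_coe_finset]
  repeat rw [Finset.card_insert_of_notMem (by
    simp only [Finset.mem_insert, Finset.mem_singleton]; omega)]
  rw [Finset.card_singleton]

lemma hasParameters_range_traceWord (hs : 2 ≤ s) (hL : Fintype.card L = 2 ^ (4 * s))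
    (hn : n = (2 ^ (2 * s) + 1) * (2 ^ s - 1)) (hβ : IsPrimitiveRoot β n) :
    HasParameters (LinearMap.range (traceWord (locators β n))) (4 * s + 1)
      (n + 1 - 2 ^ (3 * s - 1)) := by
  have hset := setOf_weights_range_traceWord hs hL hn hβ
  refine ⟨by rw [finrank_range_traceWord (traceWord_locators_injective hs hL hn hβ),
    finrank_eq hL], hasMinDist_of_hammingNorm ?_ ?_⟩
  · have : n + 1 - 2 ^ (3 * s - 1) ∈ {w | ∃ c ∈ LinearMap.range (traceWord (locators β n)),
        c ≠ 0 ∧ hammingNorm c = w} := by rw [hset]; simp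
    exact this
  · intro c hc hc0
    obtain ⟨h1, h2, h3, h4, h5⟩ := length_relations hs hn
    have : hammingNorm c ∈ {w | ∃ c ∈ LinearMap.range (traceWord (locators β n)),
        c ≠ 0 ∧ hammingNorm c = w} := ⟨c, hc, hc0, rfl⟩
    rw [hset] at this
    simp only [Finset.coe_insert, Finset.coe_singleton, Set.mem_insert_iff,
      Set.mem_singleton_iff] at this
    omega

end Main

end Coding

theorem mainTheorem2 (s n : ℕ) (hs : 2 ≤ s) (hn : n = (2 ^ (2 * s) + 1) * (2 ^ s - 1))
    {K : Type*} [Field K] [Algebra (ZMod 2) K] (β : K) (hβ : IsPrimitiveRoot β n) :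
    Coding.HasParameters (Coding.extendedCode (Coding.bchCode (ZMod 2) β n 3 1)) (n - 4 * s) 4 ∧
    Coding.IsDistanceOptimalForSpherePacking
      (Coding.extendedCode (Coding.bchCode (ZMod 2) β n 3 1)) ∧
    Coding.HasParameters
      (Coding.dualCode (Coding.extendedCode (Coding.bchCode (ZMod 2) β n 3 1)))
      (4 * s + 1) (n + 1 - 2 ^ (3 * s - 1)) ∧
    Coding.IsWeightCode 5
      (Coding.dualCode (Coding.extendedCode (Coding.bchCode (ZMod 2) β n 3 1))) ∧
    Coding.weightEnumerator
      (Coding.dualCode (Coding.extendedCode (Coding.bchCode (ZMod 2) β n 3 1))) =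
        1 + Polynomial.C n * Polynomial.X ^ (n + 1 - 2 ^ (3 * s - 1))
          + Polynomial.C (2 ^ (4 * s) - 1 - n) *
              Polynomial.X ^ (2 ^ (3 * s - 1) - 2 ^ (2 * s - 1))
          + Polynomial.C (2 ^ (4 * s) - 1 - n) *
              Polynomial.X ^ (n + 1 - 2 ^ (3 * s - 1) + 2 ^ (2 * s - 1))
          + Polynomial.C n * Polynomial.X ^ (2 ^ (3 * s - 1))
          + Polynomial.X ^ (n + 1) := by
  have hpos : 0 < n := (Nat.zero_le _).trans_lt (Coding.four_mul_lt_length hs hn)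
  let L := GaloisField 2 (4 * s)
  have : Finite L := inferInstanceAs (Finite (GaloisField 2 (4 * s)))
  have := Fintype.ofFinite L
  have hL : Fintype.card L = 2 ^ (4 * s) := by
    rw [← Nat.card_eq_fintype_card]
    exact GaloisField.card 2 (4 * s) (by omega)
  obtain ⟨ζ, hζ⟩ := FiniteField.exists_isPrimitiveRoot_of_dvd (L := L) (d := n)
    ⟨2 ^ s + 1, by rw [hL, Coding.length_mul hn]⟩
  obtain ⟨γ, hγ, hcode⟩ := Coding.exists_isPrimitiveRoot_bchCode_eq hpos hβ hζ
  rw [hcode, Coding.extendedCode_bchCode hγ.pow_eq_one, Coding.dualCode_ker_parityCheck]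
  have hparam := Coding.hasParameters_ker_parityCheck hs hL hn hγ
  exact ⟨hparam, Coding.isDistanceOptimalForSpherePacking_of_hasParameters hs hn hparam,
    Coding.hasParameters_range_traceWord hs hL hn hγ,
    Coding.isWeightCode_five_range_traceWord hs hL hn hγ,
    Coding.weightEnumerator_range_traceWord hs hL hn hγ⟩
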